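/- Let $\Omega(n)$ be the number of prime factors of $n$ counted with multiplicity. Let $\log_0 x=x$ and $\log_{i+1}x=\log_i(\log x)$ (defined for $x$ large enough), and let $\log_0^+x=x$ and $\log_{i+1}^+x=\log^+(\log_i^+x)$, where $\log^+x=\max\{\log|x|,0\}$ and $\log^+0=0$. An arithmetic function $f$ is said to have average order $g$ if $\frac1X\sum_{1\le n\le X}f(n)\asymp g(X)$ as $X\to\infty$. Then for every integer $j\ge 0$ and every real $\alpha>0$: (1) as $X\to\infty$, with an implied constant depending only on $j$ and $\alpha$, \[ \sum_{1\le n\le X}\bigl(\log_j^+\Omega(n)\bigr)^\alpha = X(\log_{j+2}X)^\alpha+O\!\left(\frac{X(\log_{j+2}X)^\alpha}{\log_2X}\right); \] (2) the function $(\log_j^+\Omega(n))^\alpha$ has average order $(\log_{j+2}^+n)^\alpha$; (3) the weight $w_n=(1+\log_j^+\Omega(n))^\alpha$ also has average order $(\log_{j+2}^+n)^\alpha$. (This is the weight of the Hilbert space $\mathscr H_{\log,j}$ of Dirichlet series $\sum_{n\ge1}a_nn^{-s}$ with $\sum_{n\ge 1}|a_n|^2/w_n<\infty$.) -/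

import Mathlib

open Filter Asymptotics

noncomputable section

/-- The `j`-fold logarithm: `log_0 x = x` and `log_{j+1} x = log_j (log x)`. -/
def iterLog (j : ℕ) (x : ℝ) : ℝ := Real.log^[j] x

/-- The `j`-fold positive logarithm: `log_0^+ x = x` and `log_{j+1}^+ x = log^+ (log_j^+ x)`,
where `log^+ x = max {log |x|, 0}`. -/
def iterPosLog : ℕ → ℝ → ℝ
  | 0, x => x
  | j + 1, x => Real.posLog (iterPosLog j x)

/-- The summatory function `∑_{1 ≤ n ≤ X} f n` of an arithmetic function, for real `X`. -/
def summatory (f : ℕ → ℝ) (X : ℝ) : ℝ := ∑ n ∈ Finset.Icc 1 ⌊X⌋₊, f n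

/-- `f` has average order `g`: `(1 / X) ∑_{n ≤ X} f n ≍ g X` as `X → ∞`. -/
def HasAverageOrder (f : ℕ → ℝ) (g : ℝ → ℝ) : Prop :=
  (fun X : ℝ => 1 / X * summatory f X) =Θ[atTop] g

/-- The arithmetic function `n ↦ log_j^+ Ω(n)`, with `Ω` the number of prime factors counted
with multiplicity. -/
def iterPosLogOmega (j n : ℕ) : ℝ := iterPosLog j (ArithmeticFunction.cardFactors n : ℝ)

/-- The weight `w_n = (1 + log_j^+ Ω(n))^α` of the Hilbert space of Dirichlet series
`∑ a_n n^{-s}` with `∑ |a_n|^2 / w_n < ∞` into which composition operators map. -/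
def logWeight (j : ℕ) (α : ℝ) (n : ℕ) : ℝ := (1 + iterPosLogOmega j n) ^ α

end

/-! Put L = log log X and t(n) = Ω(n)/L. Since Ω has normal order log log n, t is concentrated at 1,
and the theorem follows from a quantitative form of this. Arithmetic input: every power moment
satisfies ∑ t(n)^k = X + O(X/L) over n ≤ X (`exists_moment_sub_le`). The upper bound comes from an
induction on k (`exists_sum_cardFactors_add_pow_le`), the lower one from the first moment; both rest
on ∑_{p ≤ N} 1/p = log log N + O(1). In ∑ (t-1)²(1+t^m) the main terms cancel, leaving O(X/L)
(`exists_weighted_variance_le`). Analytic input: (log_j^+(Lt)/log_j^+ L)^α = 1 + c(t-1) +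
O((t-1)²(1+t^m)) for all t ≥ 0, with c bounded and both bounds uniform in large L
(`exists_iterPosLog_rpow_ratio_expansion`). Summing the expansion at t = t(n) gives relative error
O(1/L), which is (1); the average orders follow. -/

/-! ### Euler products and Mertens' estimate for the sum of 1/p -/

/-- The real function `n ↦ n ^ (-s)` as a monoid homomorphism on the natural numbers. -/
noncomputable def natRpowNegHom (s : ℝ) : ℕ →* ℝ where
  toFun n := (n : ℝ) ^ (-s)
  map_one' := by simp
  map_mul' m n := by
    rw [Nat.cast_mul, Real.mul_rpow (Nat.cast_nonneg m) (Nat.cast_nonneg n)]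

theorem natRpowNegHom_apply (s : ℝ) (n : ℕ) : natRpowNegHom s n = (n : ℝ) ^ (-s) := rfl

theorem hasSum_smoothNumbers_rpow_neg {s : ℝ} (hs : 0 < s) (N : ℕ) :
    HasSum (fun m : N.smoothNumbers => ((m : ℕ) : ℝ) ^ (-s))
      (∏ p ∈ N.primesBelow, (1 - (p : ℝ) ^ (-s))⁻¹) := by
  refine (EulerProduct.summable_and_hasSum_smoothNumbers_prod_primesBelow_geometric
    (f := natRpowNegHom s) ?_ N).2
  intro p hp
  rw [natRpowNegHom_apply, Real.norm_of_nonneg (by positivity)]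
  exact Real.rpow_lt_one_of_one_lt_of_neg (by exact_mod_cast hp.one_lt) (by linarith)

theorem neg_log_one_sub_le {x : ℝ} (hx : x ≤ 1 / 2) :
    -Real.log (1 - x) ≤ x + 2 * x ^ 2 := by
  have h1 : 0 < 1 - x := by linarith
  have h2 := Real.one_sub_inv_le_log_of_pos h1
  have h3 : (1 - x)⁻¹ ≤ 1 + x + 2 * x ^ 2 := by
    rw [inv_le_iff_one_le_mul₀ h1]
    nlinarith [mul_nonneg (sq_nonneg x) (by linarith : (0 : ℝ) ≤ 1 - 2 * x)]
  linarith

/-- The sum of the reciprocals of the primes up to `N`. -/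
noncomputable def primeRecipSum (N : ℕ) : ℝ := ∑ p ∈ N.primesLE, (p : ℝ)⁻¹

theorem primeRecipSum_nonneg (N : ℕ) : 0 ≤ primeRecipSum N :=
  Finset.sum_nonneg fun _ _ => by positivity

/-- Every n ≤ N is a product of primes ≤ N, so the finite Euler product at s = 1 dominates the
harmonic sum, hence log(N+1). Taking logarithms costs only the convergent sum of 2/n². -/
theorem exists_log_log_le_primeRecipSum :
    ∃ C : ℝ, 0 ≤ C ∧ ∀ N : ℕ, 2 ≤ N → Real.log (Real.log (N + 1)) ≤ primeRecipSum N + C := by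
  have hsum : Summable fun n : ℕ => 2 * ((n : ℝ) ^ 2)⁻¹ :=
    (Real.summable_nat_pow_inv.mpr one_lt_two).mul_left 2
  refine ⟨∑' n : ℕ, 2 * ((n : ℝ) ^ 2)⁻¹, tsum_nonneg fun n => by positivity, fun N hN => ?_⟩
  have hE := hasSum_smoothNumbers_rpow_neg one_pos (N + 1)
  have hpos : ∀ p ∈ (N + 1).primesBelow, (p : ℝ) ^ (-1 : ℝ) ≤ 1 / 2 := by
    intro p hp
    have h2 : (2 : ℝ) ≤ p := by exact_mod_cast Nat.two_le_of_mem_primesBelow hp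
    rw [Real.rpow_neg_one]
    rw [one_div]
    exact inv_anti₀ two_pos h2
  have hharm : Real.log (N + 1) ≤ ∏ p ∈ (N + 1).primesBelow, (1 - (p : ℝ) ^ (-1 : ℝ))⁻¹ := by
    have h1 := log_add_one_le_harmonic N
    have h2 : ((harmonic N : ℚ) : ℝ) = ∑ i ∈ Finset.Icc 1 N, ((i : ℝ))⁻¹ := by
      rw [harmonic_eq_sum_Icc]; push_cast; rfl
    rw [h2] at h1
    refine (by exact_mod_cast h1 : Real.log (N + 1) ≤ _).trans ?_
    rw [← Finset.sum_attach]
    let e : {x // x ∈ Finset.Icc 1 N} ↪ (N + 1).smoothNumbers :=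
      ⟨fun i => ⟨i.1, Nat.mem_smoothNumbers_of_lt (Finset.mem_Icc.mp i.2).1
        (Nat.lt_succ_of_le (Finset.mem_Icc.mp i.2).2)⟩, fun a b h =>
          Subtype.ext (congrArg (fun z : (N + 1).smoothNumbers => (z : ℕ)) h)⟩
    have h3 := sum_le_hasSum ((Finset.Icc 1 N).attach.map e) (fun i _ => by positivity) hE
    rw [Finset.sum_map] at h3
    simp only [Real.rpow_neg_one] at h3 ⊢
    exact h3
  have hlogN : 0 < Real.log (N + 1) := Real.log_pos (by
    have : (2 : ℝ) ≤ N := by exact_mod_cast hN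
    linarith)
  refine (Real.log_le_log hlogN hharm).trans ?_
  rw [Real.log_prod (fun p hp => inv_ne_zero (by linarith [hpos p hp]))]
  calc ∑ p ∈ (N + 1).primesBelow, Real.log (1 - (p : ℝ) ^ (-1 : ℝ))⁻¹
      ≤ ∑ p ∈ (N + 1).primesBelow, ((p : ℝ)⁻¹ + 2 * ((p : ℝ) ^ 2)⁻¹) := by
        refine Finset.sum_le_sum fun p hp => ?_
        have h := neg_log_one_sub_le (hpos p hp)
        rw [Real.log_inv]
        simpa [Real.rpow_neg_one] using h
    _ ≤ _ := by
        rw [Finset.sum_add_distrib]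
        exact add_le_add le_rfl (hsum.sum_le_tsum _ fun i _ => by positivity)

/-- Chebyshev's argument: log N! = ∑ Λ(n)⌊N/n⌋ is at most N log N, and only the primes are kept on
the right. Removing the floors costs θ(N) ≤ N log 4. -/
theorem sum_log_div_primesLE_le {N : ℕ} (hN : 1 ≤ N) :
    ∑ p ∈ N.primesLE, Real.log p / p ≤ Real.log N + Real.log 4 := by
  have hN0 : (0 : ℝ) < N := by exact_mod_cast hN
  have h1 : ∑ n ∈ Finset.Ioc 0 N, Real.log n
      = ∑ n ∈ Finset.Ioc 0 N, ArithmeticFunction.vonMangoldt n * ((N / n : ℕ) : ℝ) := by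
    rw [← ArithmeticFunction.sum_Ioc_mul_zeta_eq_sum]
    refine Finset.sum_congr rfl fun n _ => ?_
    rw [ArithmeticFunction.vonMangoldt_mul_zeta]
    rfl
  have h2 : ∑ n ∈ Finset.Ioc 0 N, Real.log n ≤ N * Real.log N := by
    calc ∑ n ∈ Finset.Ioc 0 N, Real.log n ≤ ∑ n ∈ Finset.Ioc 0 N, Real.log N := by
          refine Finset.sum_le_sum fun n hn => ?_
          rw [Finset.mem_Ioc] at hn
          exact Real.log_le_log (by exact_mod_cast hn.1) (by exact_mod_cast hn.2)
      _ = N * Real.log N := by simp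
  have h3 : ∑ p ∈ N.primesLE, Real.log p * ((N / p : ℕ) : ℝ)
      ≤ ∑ n ∈ Finset.Ioc 0 N, ArithmeticFunction.vonMangoldt n * ((N / n : ℕ) : ℝ) := by
    rw [Nat.primesLE_eq_filter_Ioc_zero, Finset.sum_filter]
    refine Finset.sum_le_sum fun n _ => ?_
    split_ifs with hp
    · rw [ArithmeticFunction.vonMangoldt_apply_prime hp]
    · exact mul_nonneg ArithmeticFunction.vonMangoldt_nonneg (Nat.cast_nonneg _)
  have h4 : ∑ p ∈ N.primesLE, Real.log p ≤ Real.log 4 * N := by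
    rw [← Chebyshev.theta_eq_sum_primesLE_log]
    exact Chebyshev.theta_le_log4_mul_x hN0.le
  have h5 : N * ∑ p ∈ N.primesLE, Real.log p / p
      ≤ ∑ p ∈ N.primesLE, Real.log p * ((N / p : ℕ) : ℝ) + ∑ p ∈ N.primesLE, Real.log p := by
    rw [Finset.mul_sum, ← Finset.sum_add_distrib]
    refine Finset.sum_le_sum fun p hp => ?_
    have hp1 := Nat.one_lt_of_mem_primesLE hp
    have hl : 0 ≤ Real.log p := Real.log_nonneg (by exact_mod_cast hp1.le)
    have hf : (N : ℝ) / p ≤ ((N / p : ℕ) : ℝ) + 1 := by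
      rw [← Nat.floor_div_eq_div (K := ℝ)]
      exact (Nat.lt_floor_add_one _).le
    calc N * (Real.log p / p) = Real.log p * (N / p) := by ring
      _ ≤ Real.log p * (((N / p : ℕ) : ℝ) + 1) := mul_le_mul_of_nonneg_left hf hl
      _ = _ := by ring
  refine le_of_mul_le_mul_left ?_ hN0
  linarith

/-- Telescoping substitute for comparing the sum of n^(-1-δ) with its integral. -/
theorem mul_rpow_neg_one_sub_le {δ : ℝ} (hδ : 0 < δ) {n : ℕ} (hn : 1 ≤ n) :
    δ * ((n + 1 : ℕ) : ℝ) ^ (-(1 + δ)) ≤ (n : ℝ) ^ (-δ) - ((n + 1 : ℕ) : ℝ) ^ (-δ) := by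
  have hn0 : (0 : ℝ) < n := by exact_mod_cast hn
  have hn1 : (0 : ℝ) < ((n + 1 : ℕ) : ℝ) := by positivity
  have h1 : ((n + 1 : ℕ) : ℝ) ^ (-(1 + δ))
      = ((n + 1 : ℕ) : ℝ) ^ (-δ) * ((n + 1 : ℕ) : ℝ)⁻¹ := by
    rw [← Real.rpow_neg_one, ← Real.rpow_add hn1]; ring_nf
  have h2 : (n : ℝ) ^ (-δ)
      = ((n + 1 : ℕ) : ℝ) ^ (-δ) * (n / ((n + 1 : ℕ) : ℝ)) ^ (-δ) := by
    rw [← Real.mul_rpow hn1.le (by positivity)]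
    congr 1
    field_simp
  have h3 : 1 + δ * ((n + 1 : ℕ) : ℝ)⁻¹ ≤ (n / ((n + 1 : ℕ) : ℝ)) ^ (-δ) := by
    rw [Real.rpow_def_of_pos (by positivity)]
    have h4 := Real.log_le_sub_one_of_pos (show (0 : ℝ) < n / ((n + 1 : ℕ) : ℝ) by positivity)
    have h5 : (n : ℝ) / ((n + 1 : ℕ) : ℝ) - 1 = -((n + 1 : ℕ) : ℝ)⁻¹ := by
      push_cast; field_simp; ring
    rw [h5] at h4
    have h6 : δ * ((n + 1 : ℕ) : ℝ)⁻¹ ≤ Real.log (n / ((n + 1 : ℕ) : ℝ)) * -δ := by nlinarith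
    have := Real.add_one_le_exp (Real.log (n / ((n + 1 : ℕ) : ℝ)) * -δ)
    linarith
  have h7 := mul_le_mul_of_nonneg_left h3 (Real.rpow_nonneg hn1.le (-δ))
  rw [h1, h2]
  linarith

theorem tsum_nat_rpow_neg_le {δ : ℝ} (hδ : 0 < δ) :
    ∑' n : ℕ, (n : ℝ) ^ (-(1 + δ)) ≤ 1 + δ⁻¹ := by
  have hs : Summable fun n : ℕ => (n : ℝ) ^ (-(1 + δ)) :=
    Real.summable_nat_rpow.mpr (by linarith)
  refine hs.tsum_le_of_sum_range_le fun N => ?_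
  have key : ∀ M : ℕ, ∑ n ∈ Finset.range (M + 2), (n : ℝ) ^ (-(1 + δ))
      ≤ 1 + δ⁻¹ - δ⁻¹ * ((M + 1 : ℕ) : ℝ) ^ (-δ) := by
    intro M
    induction M with
    | zero =>
      -- The term n = 0 of the sum vanishes because `0 ^ x = 0` for real x ≠ 0.
      have : -δ + -1 ≠ 0 := by linarith
      simp [Finset.sum_range_succ, Real.zero_rpow this]
    | succ M ih =>
      rw [Finset.sum_range_succ]
      have h := mul_le_mul_of_nonneg_left (mul_rpow_neg_one_sub_le hδ (Nat.le_add_left 1 M))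
        (inv_nonneg.mpr hδ.le)
      rw [← mul_assoc, inv_mul_cancel₀ hδ.ne', one_mul] at h
      have e : M + 2 = M + 1 + 1 := rfl
      rw [e] at *
      linarith
  refine (Finset.sum_le_sum_of_subset_of_nonneg (Finset.range_mono (by lia : N ≤ N + 2))
    fun i _ _ => by positivity).trans ((key N).trans ?_)
  have : 0 ≤ δ⁻¹ * ((N + 1 : ℕ) : ℝ) ^ (-δ) := by positivity
  linarith

/-- The Euler product is at most ζ(1+δ) ≤ 1 + 1/δ; take logarithms and use x ≤ -log(1-x). -/
theorem sum_primesLE_rpow_neg_le {δ : ℝ} (hδ : 0 < δ) (N : ℕ) :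
    ∑ p ∈ N.primesLE, (p : ℝ) ^ (-(1 + δ)) ≤ Real.log (1 + δ⁻¹) := by
  have hE := hasSum_smoothNumbers_rpow_neg (by linarith : 0 < 1 + δ) (N + 1)
  have hs : Summable fun n : ℕ => (n : ℝ) ^ (-(1 + δ)) :=
    Real.summable_nat_rpow.mpr (by linarith)
  have hlt : ∀ p ∈ (N + 1).primesBelow, (p : ℝ) ^ (-(1 + δ)) < 1 := fun p hp =>
    Real.rpow_lt_one_of_one_lt_of_neg
      (by exact_mod_cast Nat.one_lt_of_mem_primesBelow hp) (by linarith)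
  have hle : ∏ p ∈ (N + 1).primesBelow, (1 - (p : ℝ) ^ (-(1 + δ)))⁻¹ ≤ 1 + δ⁻¹ := by
    rw [← hE.tsum_eq]
    exact (hs.tsum_subtype_le _ _ fun n => by positivity).trans (tsum_nat_rpow_neg_le hδ)
  have hpos : 0 < ∏ p ∈ (N + 1).primesBelow, (1 - (p : ℝ) ^ (-(1 + δ)))⁻¹ :=
    Finset.prod_pos fun p hp => inv_pos.mpr (by linarith [hlt p hp])
  refine le_trans ?_ (Real.log_le_log hpos hle)
  rw [Real.log_prod (fun p hp => inv_ne_zero (by linarith [hlt p hp]))]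
  refine Finset.sum_le_sum fun p hp => ?_
  rw [Real.log_inv]
  linarith [Real.log_le_sub_one_of_pos (sub_pos.mpr (hlt p hp))]

/-- With δ = 1/log N, the inequality p^(-δ) ≥ 1 - δ log p gives 1/p ≤ p^(-1-δ) + δ (log p)/p. The
two sums are at most log(1 + log N) and 1 + log 4. -/
theorem exists_primeRecipSum_le :
    ∃ C : ℝ, 0 ≤ C ∧ ∀ N : ℕ, 3 ≤ N → primeRecipSum N ≤ Real.log (Real.log N) + C := by
  refine ⟨Real.log 2 + 1 + Real.log 4, by positivity, fun N hN => ?_⟩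
  have hN3 : (3 : ℝ) ≤ N := by exact_mod_cast hN
  have hlog : 1 ≤ Real.log N := by
    rw [Real.le_log_iff_exp_le (by linarith)]
    linarith [Real.exp_one_lt_d9]
  have hlog0 : 0 < Real.log N := by linarith
  set δ := (Real.log N)⁻¹ with hδ
  have hδ0 : 0 < δ := inv_pos.mpr hlog0
  have h1 := sum_primesLE_rpow_neg_le hδ0 N
  have h2 := sum_log_div_primesLE_le (by lia : 1 ≤ N)
  have h3 : primeRecipSum N ≤ ∑ p ∈ N.primesLE, (p : ℝ) ^ (-(1 + δ))
      + δ * ∑ p ∈ N.primesLE, Real.log p / p := by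
    rw [primeRecipSum, Finset.mul_sum, ← Finset.sum_add_distrib]
    refine Finset.sum_le_sum fun p hp => ?_
    have hp0 : (0 : ℝ) < p := by exact_mod_cast (Nat.prime_of_mem_primesLE hp).pos
    have h4 : (p : ℝ) ^ (-(1 + δ)) = (p : ℝ)⁻¹ * (p : ℝ) ^ (-δ) := by
      rw [← Real.rpow_neg_one, ← Real.rpow_add hp0]; ring_nf
    have h5 : 1 - δ * Real.log p ≤ (p : ℝ) ^ (-δ) := by
      rw [Real.rpow_def_of_pos hp0]
      linarith [Real.add_one_le_exp (Real.log p * -δ)]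
    have h6 := mul_le_mul_of_nonneg_left h5 (inv_nonneg.mpr hp0.le)
    rw [h4, div_eq_mul_inv]
    linarith
  have h4 : δ * ∑ p ∈ N.primesLE, Real.log p / p ≤ 1 + Real.log 4 := by
    refine (mul_le_mul_of_nonneg_left h2 hδ0.le).trans ?_
    rw [mul_add, hδ, inv_mul_cancel₀ hlog0.ne']
    have h7 : (Real.log N)⁻¹ ≤ 1 := inv_le_one_of_one_le₀ hlog
    have h8 : 0 ≤ Real.log 4 := Real.log_nonneg (by norm_num)
    nlinarith
  have h5 : Real.log (1 + δ⁻¹) ≤ Real.log 2 + Real.log (Real.log N) := by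
    rw [← Real.log_mul two_ne_zero hlog0.ne', hδ, inv_inv]
    exact Real.log_le_log (by linarith) (by linarith)
  linarith

/-! ### Power moments of Ω -/

theorem cardFactors_eq_sum_prime_pow_dvd {n N : ℕ} (hn : 1 ≤ n) (hnN : n ≤ N) :
    (ArithmeticFunction.cardFactors n : ℝ)
      = ∑ p ∈ N.primesLE, ∑ a ∈ Finset.Icc 1 N, if p ^ a ∣ n then (1 : ℝ) else 0 := by
  have hsub : n.factorization.support ⊆ N.primesLE := fun p hp => by
    rw [Nat.support_factorization] at hp
    exact Nat.mem_primesLE.mpr ⟨(Nat.le_of_mem_primeFactors hp).trans hnN,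
      Nat.prime_of_mem_primeFactors hp⟩
  rw [ArithmeticFunction.cardFactors_eq_sum_factorization, Finsupp.sum_of_support_subset _ hsub _
    (fun _ _ => rfl), Nat.cast_sum]
  refine Finset.sum_congr rfl fun p hp => ?_
  have hpp := Nat.prime_of_mem_primesLE hp
  rw [Nat.factorization_eq_card_pow_dvd n hpp, Nat.Ico_filter_pow_dvd_eq hpp (by lia)
    (hnN.trans (Nat.lt_pow_self hpp.one_lt).le), Finset.sum_boole]

theorem sum_Icc_ite_dvd (F : ℕ → ℝ) {d : ℕ} (hd : 0 < d) (M : ℕ) :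
    (∑ n ∈ Finset.Icc 1 M, if d ∣ n then F n else 0) = ∑ m ∈ Finset.Icc 1 (M / d), F (d * m) := by
  rw [← Finset.sum_filter]
  symm
  refine Finset.sum_nbij (d * ·) ?_ ?_ ?_ fun _ _ => rfl
  · intro m hm
    rw [Finset.mem_Icc, Nat.le_div_iff_mul_le hd] at hm
    rw [Finset.mem_filter, Finset.mem_Icc]
    exact ⟨⟨Nat.mul_pos hd hm.1, by linarith [hm.2]⟩, dvd_mul_right _ _⟩
  · intro a _ b _ h
    exact Nat.eq_of_mul_eq_mul_left hd h
  · intro n hn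
    rw [Finset.mem_coe, Finset.mem_filter, Finset.mem_Icc] at hn
    obtain ⟨m, rfl⟩ := hn.2
    refine ⟨m, ?_, rfl⟩
    rw [Finset.mem_coe, Finset.mem_Icc, Nat.le_div_iff_mul_le hd]
    exact ⟨Nat.pos_of_mul_pos_left hn.1.1, by linarith [hn.1.2]⟩

theorem sum_cardFactors_mul {M N : ℕ} (hMN : M ≤ N) (F : ℕ → ℝ) :
    ∑ n ∈ Finset.Icc 1 M, (ArithmeticFunction.cardFactors n : ℝ) * F n
      = ∑ p ∈ N.primesLE, ∑ a ∈ Finset.Icc 1 N, ∑ m ∈ Finset.Icc 1 (M / p ^ a), F (p ^ a * m) := by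
  calc ∑ n ∈ Finset.Icc 1 M, (ArithmeticFunction.cardFactors n : ℝ) * F n
      = ∑ n ∈ Finset.Icc 1 M, ∑ p ∈ N.primesLE, ∑ a ∈ Finset.Icc 1 N,
          if p ^ a ∣ n then F n else 0 := by
        refine Finset.sum_congr rfl fun n hn => ?_
        rw [Finset.mem_Icc] at hn
        rw [cardFactors_eq_sum_prime_pow_dvd hn.1 (hn.2.trans hMN), Finset.sum_mul]
        simp only [Finset.sum_mul, ite_mul, one_mul, zero_mul]
    _ = _ := by
        rw [Finset.sum_comm]
        refine Finset.sum_congr rfl fun p hp => ?_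
        rw [Finset.sum_comm]
        exact Finset.sum_congr rfl fun a _ =>
          sum_Icc_ite_dvd F (pow_pos (Nat.prime_of_mem_primesLE hp).pos a) M

/-- Higher prime powers contribute boundedly to the polynomial moments. -/
theorem exists_sum_higher_prime_pow_le (k : ℕ) :
    ∃ D : ℝ, 0 ≤ D ∧ ∀ N : ℕ, ∑ p ∈ N.primesLE, ∑ a ∈ Finset.Icc 2 N,
      ((p : ℝ) ^ a)⁻¹ * (1 + a) ^ k ≤ D := by
  have h1 : Summable fun n : ℕ => ((n : ℝ) ^ 2)⁻¹ := Real.summable_nat_pow_inv.mpr one_lt_two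
  have h2 : Summable fun a : ℕ => 4 * (((1 + a : ℕ) : ℝ) ^ k * (1 / 2 : ℝ) ^ a) := by
    have h := (summable_nat_add_iff (f := fun a : ℕ => (a : ℝ) ^ k * (1 / 2 : ℝ) ^ a) 1).mpr
      (summable_pow_mul_geometric_of_norm_lt_one k (show ‖(1 / 2 : ℝ)‖ < 1 by norm_num))
    refine (h.mul_left 8).congr fun a => ?_
    rw [pow_succ, add_comm 1 a]
    ring
  refine ⟨(∑' n : ℕ, ((n : ℝ) ^ 2)⁻¹) * ∑' a : ℕ, 4 * (((1 + a : ℕ) : ℝ) ^ k * (1 / 2 : ℝ) ^ a),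
    mul_nonneg (tsum_nonneg fun _ => by positivity) (tsum_nonneg fun _ => by positivity),
    fun N => ?_⟩
  calc ∑ p ∈ N.primesLE, ∑ a ∈ Finset.Icc 2 N, ((p : ℝ) ^ a)⁻¹ * (1 + a) ^ k
      ≤ ∑ p ∈ N.primesLE, ∑ a ∈ Finset.Icc 2 N,
          -- Since p ≥ 2, p^(-a) ≤ p^(-2) · 2^(2-a), which decouples p from a; the 4 is 2².
          ((p : ℝ) ^ 2)⁻¹ * (4 * (((1 + a : ℕ) : ℝ) ^ k * (1 / 2 : ℝ) ^ a)) := by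
        refine Finset.sum_le_sum fun p hp => Finset.sum_le_sum fun a ha => ?_
        have hp2 : (2 : ℝ) ≤ p := by exact_mod_cast Nat.two_le_of_mem_primesLE hp
        obtain ⟨b, rfl⟩ := Nat.exists_eq_add_of_le (Finset.mem_Icc.mp ha).1
        have h3 : ((p : ℝ) ^ (2 + b))⁻¹ ≤ ((p : ℝ) ^ 2)⁻¹ * (1 / 2 : ℝ) ^ b := by
          rw [pow_add, mul_inv, ← inv_pow _ b, one_div]
          gcongr
        calc ((p : ℝ) ^ (2 + b))⁻¹ * (1 + ((2 + b : ℕ) : ℝ)) ^ k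
            ≤ (((p : ℝ) ^ 2)⁻¹ * (1 / 2 : ℝ) ^ b) * (1 + ((2 + b : ℕ) : ℝ)) ^ k := by gcongr
          _ = _ := by push_cast; rw [pow_add (1 / 2 : ℝ) 2 b]; ring
    _ = (∑ p ∈ N.primesLE, ((p : ℝ) ^ 2)⁻¹)
          * ∑ a ∈ Finset.Icc 2 N, 4 * (((1 + a : ℕ) : ℝ) ^ k * (1 / 2 : ℝ) ^ a) := by
        rw [Finset.sum_mul_sum]
    _ ≤ _ := mul_le_mul (h1.sum_le_tsum _ fun _ _ => by positivity)
        (h2.sum_le_tsum _ fun _ _ => by positivity)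
        (Finset.sum_nonneg fun _ _ => by positivity) (tsum_nonneg fun _ => by positivity)

/-- Expand one factor Ω(n) over prime powers p^a dividing n and write n = p^a m. As Ω(p^a m) = a +
Ω(m), the inductive hypothesis applies to m ≤ M/p^a with shift a + b. This is why b is arbitrary and
why M may be smaller than the N that bounds the primes. The coefficient 1 of the prime sum matters:
it yields the exact main term X later. -/
theorem exists_sum_cardFactors_add_pow_le (k : ℕ) :
    ∃ C : ℝ, 1 ≤ C ∧ ∀ N M : ℕ, M ≤ N → ∀ b : ℕ,
      ∑ n ∈ Finset.Icc 1 M, ((ArithmeticFunction.cardFactors n : ℝ) + b) ^ k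
        ≤ M * (primeRecipSum N + C + b) ^ k := by
  induction k with
  | zero => exact ⟨1, le_rfl, fun N M _ b => by simp⟩
  | succ k ih =>
    obtain ⟨C, hC, ih⟩ := ih
    obtain ⟨D, hD0, hD⟩ := exists_sum_higher_prime_pow_le k
    refine ⟨C + 1 + D, by linarith, fun N M hMN b => ?_⟩
    have hA := primeRecipSum_nonneg N
    have hb : (0 : ℝ) ≤ b := Nat.cast_nonneg b
    set z : ℝ := primeRecipSum N + C + b with hz
    have hz1 : 1 ≤ z := by linarith
    have hinner : ∀ p ∈ N.primesLE, ∀ a ∈ Finset.Icc 1 N,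
        ∑ m ∈ Finset.Icc 1 (M / p ^ a),
          ((ArithmeticFunction.cardFactors (p ^ a * m) : ℝ) + b) ^ k
        ≤ M * (((p : ℝ) ^ a)⁻¹ * (z + a) ^ k) := by
      intro p hp a _
      have hpp := Nat.prime_of_mem_primesLE hp
      have h1 := ih N (M / p ^ a) ((Nat.div_le_self _ _).trans hMN) (a + b)
      calc ∑ m ∈ Finset.Icc 1 (M / p ^ a),
            ((ArithmeticFunction.cardFactors (p ^ a * m) : ℝ) + b) ^ k
          = ∑ m ∈ Finset.Icc 1 (M / p ^ a),
            ((ArithmeticFunction.cardFactors m : ℝ) + ((a + b : ℕ) : ℝ)) ^ k := by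
            refine Finset.sum_congr rfl fun m hm => ?_
            rw [ArithmeticFunction.cardFactors_mul (pow_ne_zero _ hpp.ne_zero)
              (by have := (Finset.mem_Icc.mp hm).1; lia),
              ArithmeticFunction.cardFactors_apply_prime_pow hpp]
            push_cast
            ring
        _ ≤ _ := h1
        _ ≤ (M / (p : ℝ) ^ a) * (z + a) ^ k := by
            have h2 : ((M / p ^ a : ℕ) : ℝ) ≤ M / (p : ℝ) ^ a := by
              exact_mod_cast Nat.cast_div_le (α := ℝ) (m := M) (n := p ^ a)
            have h3 : primeRecipSum N + C + ((a + b : ℕ) : ℝ) = z + a := by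
              rw [hz]; push_cast; ring
            rw [h3]
            gcongr
        _ = _ := by ring
    have hmain : ∑ p ∈ N.primesLE, ∑ a ∈ Finset.Icc 1 N, ((p : ℝ) ^ a)⁻¹ * (z + a) ^ k
        ≤ (primeRecipSum N + D) * (z + 1) ^ k := by
      have hsplit : ∀ p ∈ N.primesLE,
          ∑ a ∈ Finset.Icc 1 N, ((p : ℝ) ^ a)⁻¹ * (z + a) ^ k
            ≤ (p : ℝ)⁻¹ * (z + 1) ^ k
              + z ^ k * ∑ a ∈ Finset.Icc 2 N, ((p : ℝ) ^ a)⁻¹ * (1 + a) ^ k := by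
        intro p hp
        have hN1 : 1 ≤ N := (Nat.one_lt_of_mem_primesLE hp).le.trans (Nat.le_of_mem_primesLE hp)
        rw [← Finset.add_sum_Ioc_eq_sum_Icc hN1, Finset.mul_sum]
        refine add_le_add (by simp) ?_
        have e : Finset.Ioc 1 N = Finset.Icc 2 N := by ext; simp; lia
        rw [e]
        refine Finset.sum_le_sum fun a _ => ?_
        -- As z ≥ 1, z factors out and the higher prime powers leave a sum bounded by D.
        have h1 : z + a ≤ z * (1 + a) := by nlinarith [(Nat.cast_nonneg a : (0 : ℝ) ≤ a)]
        calc ((p : ℝ) ^ a)⁻¹ * (z + a) ^ k ≤ ((p : ℝ) ^ a)⁻¹ * (z * (1 + a)) ^ k := by gcongr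
          _ = _ := by rw [mul_pow]; ring
      refine (Finset.sum_le_sum hsplit).trans ?_
      rw [Finset.sum_add_distrib, ← Finset.sum_mul, ← Finset.mul_sum]
      have h2 : z ^ k ≤ (z + 1) ^ k := by gcongr; linarith
      have h3 := mul_le_mul h2 (hD N) (Finset.sum_nonneg fun _ _ =>
        Finset.sum_nonneg fun _ _ => by positivity) (by positivity)
      change primeRecipSum N * _ + _ ≤ _
      linarith
    have hfirst : ∑ n ∈ Finset.Icc 1 M, (ArithmeticFunction.cardFactors n : ℝ)
        * ((ArithmeticFunction.cardFactors n : ℝ) + b) ^ k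
        ≤ M * ((primeRecipSum N + D) * (z + 1) ^ k) := by
      rw [sum_cardFactors_mul hMN fun n => ((ArithmeticFunction.cardFactors n : ℝ) + b) ^ k]
      refine (Finset.sum_le_sum fun p hp => Finset.sum_le_sum fun a ha => hinner p hp a ha).trans ?_
      simp only [← Finset.mul_sum]
      exact mul_le_mul_of_nonneg_left hmain (Nat.cast_nonneg M)
    have hsecond : ∑ n ∈ Finset.Icc 1 M, (b : ℝ)
        * ((ArithmeticFunction.cardFactors n : ℝ) + b) ^ k ≤ M * (b * (z + 1) ^ k) := by
      rw [← Finset.mul_sum]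
      have h1 : z ^ k ≤ (z + 1) ^ k := by gcongr; linarith
      have h2 := (ih N M hMN b).trans (mul_le_mul_of_nonneg_left h1 (Nat.cast_nonneg M))
      calc _ ≤ (b : ℝ) * (M * (z + 1) ^ k) := mul_le_mul_of_nonneg_left h2 hb
        _ = _ := by ring
    calc ∑ n ∈ Finset.Icc 1 M, ((ArithmeticFunction.cardFactors n : ℝ) + b) ^ (k + 1)
        = ∑ n ∈ Finset.Icc 1 M, (ArithmeticFunction.cardFactors n : ℝ)
            * ((ArithmeticFunction.cardFactors n : ℝ) + b) ^ k
          + ∑ n ∈ Finset.Icc 1 M, (b : ℝ)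
            * ((ArithmeticFunction.cardFactors n : ℝ) + b) ^ k := by
          rw [← Finset.sum_add_distrib]
          exact Finset.sum_congr rfl fun n _ => by ring
      _ ≤ M * ((primeRecipSum N + D) * (z + 1) ^ k) + M * (b * (z + 1) ^ k) :=
          add_le_add hfirst hsecond
      _ = M * ((z + 1) ^ k * (primeRecipSum N + D + b)) := by ring
      _ ≤ M * ((primeRecipSum N + (C + 1 + D) + b) ^ k
            * (primeRecipSum N + (C + 1 + D) + b)) := by
          refine mul_le_mul_of_nonneg_left (mul_le_mul (pow_le_pow_left₀ (by linarith)
            (by linarith) k) (by linarith) (by linarith) (pow_nonneg (by linarith) k))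
            (Nat.cast_nonneg M)
      _ = _ := by rw [pow_succ]

/-- Only the terms a = 1 are kept; the floors then cost at most π(N) ≤ N. -/
theorem le_sum_cardFactors (N : ℕ) :
    N * primeRecipSum N - N ≤ ∑ n ∈ Finset.Icc 1 N, (ArithmeticFunction.cardFactors n : ℝ) := by
  have h := sum_cardFactors_mul (le_refl N) fun _ => (1 : ℝ)
  simp only [mul_one, Finset.sum_const, Nat.card_Icc, add_tsub_cancel_right, nsmul_eq_mul] at h
  rw [h]
  have h1 : ∀ p ∈ N.primesLE, (N : ℝ) * (p : ℝ)⁻¹ - 1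
      ≤ ∑ a ∈ Finset.Icc 1 N, ((N / p ^ a : ℕ) : ℝ) := by
    intro p hp
    have hN1 : 1 ≤ N := (Nat.one_lt_of_mem_primesLE hp).le.trans (Nat.le_of_mem_primesLE hp)
    have h2 := Finset.single_le_sum (f := fun a => ((N / p ^ a : ℕ) : ℝ))
      (fun _ _ => Nat.cast_nonneg _) (Finset.mem_Icc.mpr ⟨le_rfl, hN1⟩)
    refine le_trans ?_ h2
    have hf : (N : ℝ) / p ≤ ((N / p : ℕ) : ℝ) + 1 := by
      rw [← Nat.floor_div_eq_div (K := ℝ)]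
      exact (Nat.lt_floor_add_one _).le
    simp only [pow_one]
    rw [div_eq_mul_inv] at hf
    linarith
  refine le_trans ?_ (Finset.sum_le_sum h1)
  rw [Finset.sum_sub_distrib, ← Finset.mul_sum, primeRecipSum]
  have h3 : N.primesLE.card ≤ N := by
    rw [Nat.primesLE_eq_filter_Icc_one]
    simpa using Finset.card_filter_le (Finset.Icc 1 N) Nat.Prime
  have h4 : (N.primesLE.card : ℝ) ≤ N := by exact_mod_cast h3
  simp only [Finset.sum_const, nsmul_eq_mul, mul_one]
  linarith

/-- Chord bound from convexity in s. At s = 1/L it turns (1 + c/L)^k into 1 + O(1/L). -/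
theorem one_add_mul_pow_le {s c : ℝ} (hs0 : 0 ≤ s) (hs1 : s ≤ 1) (hc : 0 ≤ c) (k : ℕ) :
    (1 + s * c) ^ k ≤ 1 + s * ((1 + c) ^ k - 1) := by
  induction k with
  | zero => simp
  | succ k ih =>
    have hB : 0 ≤ (1 + c) ^ k - 1 := sub_nonneg.mpr (one_le_pow₀ (by linarith))
    calc (1 + s * c) ^ (k + 1) = (1 + s * c) ^ k * (1 + s * c) := pow_succ _ _
      _ ≤ (1 + s * ((1 + c) ^ k - 1)) * (1 + s * c) :=
          mul_le_mul_of_nonneg_right ih (by positivity)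
      _ = 1 + s * (((1 + c) ^ k - 1) + c + s * (((1 + c) ^ k - 1) * c)) := by ring
      _ ≤ 1 + s * (((1 + c) ^ k - 1) + c + 1 * (((1 + c) ^ k - 1) * c)) := by gcongr
      _ = _ := by ring

/-! ### Concentration of Ω(n) / log log X -/

theorem tendsto_log_log_atTop : Tendsto (fun X : ℝ => Real.log (Real.log X)) atTop atTop :=
  Real.tendsto_log_atTop.comp Real.tendsto_log_atTop

theorem exists_moment_sub_le (k : ℕ) :
    ∃ C : ℝ, ∀ᶠ X : ℝ in atTop,
      |∑ n ∈ Finset.Icc 1 ⌊X⌋₊,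
        ((ArithmeticFunction.cardFactors n : ℝ) / Real.log (Real.log X)) ^ k - X|
        ≤ C * (X / Real.log (Real.log X)) := by
  obtain ⟨C₁, hC₁, hmom⟩ := exists_sum_cardFactors_add_pow_le k
  obtain ⟨C₂, hC₂, hup⟩ := exists_primeRecipSum_le
  obtain ⟨C₃, hC₃, hlow⟩ := exists_log_log_le_primeRecipSum
  refine ⟨max ((1 + (C₂ + C₁)) ^ k) (1 + k * (C₃ + 1)), ?_⟩
  filter_upwards [eventually_ge_atTop 4, tendsto_log_log_atTop.eventually_ge_atTop 1]
    with X hX hL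
  set L := Real.log (Real.log X) with hLdef
  set N := ⌊X⌋₊ with hN
  have hL0 : 0 < L := by linarith
  have hX0 : 0 < X := by linarith
  have hN4 : 4 ≤ N := Nat.le_floor (by exact_mod_cast hX)
  have hNX : (N : ℝ) ≤ X := Nat.floor_le hX0.le
  have hXN : X < N + 1 := Nat.lt_floor_add_one X
  have hN3 : (3 : ℝ) ≤ N := by exact_mod_cast (by lia : 3 ≤ N)
  have hlogN : 0 < Real.log N := Real.log_pos (by linarith)
  have hlogX : 0 < Real.log X := Real.log_pos (by linarith)
  have hLX : L ≤ X := (Real.log_le_self hlogX.le).trans (Real.log_le_self hX0.le)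
  have hA1 : primeRecipSum N ≤ L + C₂ := (hup N (by lia)).trans (add_le_add
    (Real.log_le_log hlogN (Real.log_le_log (by linarith) hNX)) le_rfl)
  have hA2 : L ≤ primeRecipSum N + C₃ := le_trans (Real.log_le_log hlogX
    (Real.log_le_log hX0 hXN.le)) (hlow N (by lia))
  have hXL : 1 ≤ X / L := (one_le_div hL0).mpr hLX
  rw [abs_le]
  constructor
  -- Lower bound: Bernoulli's inequality t^k ≥ 1 + k(t-1) reduces it to the first moment.
  · have hbern : ∀ n ∈ Finset.Icc 1 N,
        1 + (k : ℝ) * ((ArithmeticFunction.cardFactors n : ℝ) / L - 1)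
          ≤ ((ArithmeticFunction.cardFactors n : ℝ) / L) ^ k := by
      intro n _
      have h0 : 0 ≤ (ArithmeticFunction.cardFactors n : ℝ) / L := by positivity
      simpa using one_add_mul_le_pow
        (a := (ArithmeticFunction.cardFactors n : ℝ) / L - 1) (by linarith) k
    have h1 := Finset.sum_le_sum hbern
    rw [Finset.sum_add_distrib, ← Finset.mul_sum, Finset.sum_sub_distrib, ← Finset.sum_div] at h1
    simp only [Finset.sum_const, Nat.card_Icc, add_tsub_cancel_right, nsmul_eq_mul, mul_one] at h1
    have h2 : (N : ℝ) - (C₃ + 1) * (X / L)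
        ≤ (∑ n ∈ Finset.Icc 1 N, (ArithmeticFunction.cardFactors n : ℝ)) / L := by
      have h3 : (N : ℝ) * L - X * (C₃ + 1)
          ≤ ∑ n ∈ Finset.Icc 1 N, (ArithmeticFunction.cardFactors n : ℝ) := by
        refine le_trans ?_ (le_sum_cardFactors N)
        have h4 := mul_le_mul_of_nonneg_left hA2 (Nat.cast_nonneg N)
        have h5 := mul_le_mul_of_nonneg_right hNX (by linarith : 0 ≤ C₃ + 1)
        linarith
      rw [le_div_iff₀ hL0]
      refine le_trans (le_of_eq ?_) h3
      field_simp
    have h6 := mul_le_mul_of_nonneg_left h2 (Nat.cast_nonneg (α := ℝ) k)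
    have h7 := mul_le_mul_of_nonneg_right
      (le_max_right ((1 + (C₂ + C₁)) ^ k) (1 + k * (C₃ + 1))) (by linarith : 0 ≤ X / L)
    linarith
  · have h1 := hmom N N le_rfl 0
    simp only [Nat.cast_zero, add_zero] at h1
    have hA0 := primeRecipSum_nonneg N
    have h2 : ∑ n ∈ Finset.Icc 1 N, ((ArithmeticFunction.cardFactors n : ℝ) / L) ^ k
        ≤ X * (1 + L⁻¹ * (C₂ + C₁)) ^ k := by
      simp only [div_pow]
      rw [← Finset.sum_div, div_le_iff₀ (by positivity), mul_assoc, ← mul_pow]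
      have e : (1 + L⁻¹ * (C₂ + C₁)) * L = L + (C₂ + C₁) := by field_simp
      rw [e]
      refine h1.trans (mul_le_mul hNX (pow_le_pow_left₀ (by linarith) (by linarith) k)
        (pow_nonneg (by linarith) k) hX0.le)
    have h3 := one_add_mul_pow_le (inv_nonneg.mpr hL0.le) (inv_le_one_of_one_le₀ hL)
      (by linarith : 0 ≤ C₂ + C₁) k
    have h4 := mul_le_mul_of_nonneg_left h3 hX0.le
    have h5 := mul_le_mul_of_nonneg_right
      (le_max_left ((1 + (C₂ + C₁)) ^ k) (1 + k * (C₃ + 1))) (by linarith : 0 ≤ X / L)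
    have h6 : X * (1 + L⁻¹ * ((1 + (C₂ + C₁)) ^ k - 1))
        = X + (1 + (C₂ + C₁)) ^ k * (X / L) - X / L := by
      field_simp
      ring
    linarith

/-- The expansion has coefficients 1, -2, 1 twice, so the main terms X of the six moments cancel. -/
theorem exists_weighted_variance_le (m : ℕ) :
    ∃ C : ℝ, ∀ᶠ X : ℝ in atTop,
      ∑ n ∈ Finset.Icc 1 ⌊X⌋₊,
        ((ArithmeticFunction.cardFactors n : ℝ) / Real.log (Real.log X) - 1) ^ 2
          * (1 + ((ArithmeticFunction.cardFactors n : ℝ) / Real.log (Real.log X)) ^ m)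
        ≤ C * (X / Real.log (Real.log X)) := by
  choose C hC using exists_moment_sub_le
  refine ⟨C 2 + 2 * C 1 + C 0 + C (m + 2) + 2 * C (m + 1) + C m, ?_⟩
  filter_upwards [hC 2, hC 1, hC 0, hC (m + 2), hC (m + 1), hC m] with X h2 h1 h0 k2 k1 k0
  rw [abs_le] at h2 h1 h0 k2 k1 k0
  set L := Real.log (Real.log X)
  have e : ∑ n ∈ Finset.Icc 1 ⌊X⌋₊, ((ArithmeticFunction.cardFactors n : ℝ) / L - 1) ^ 2
        * (1 + ((ArithmeticFunction.cardFactors n : ℝ) / L) ^ m)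
      = ∑ n ∈ Finset.Icc 1 ⌊X⌋₊, ((ArithmeticFunction.cardFactors n : ℝ) / L) ^ 2
        - 2 * ∑ n ∈ Finset.Icc 1 ⌊X⌋₊, ((ArithmeticFunction.cardFactors n : ℝ) / L) ^ 1
        + ∑ n ∈ Finset.Icc 1 ⌊X⌋₊, ((ArithmeticFunction.cardFactors n : ℝ) / L) ^ 0
        + ∑ n ∈ Finset.Icc 1 ⌊X⌋₊, ((ArithmeticFunction.cardFactors n : ℝ) / L) ^ (m + 2)
        - 2 * ∑ n ∈ Finset.Icc 1 ⌊X⌋₊, ((ArithmeticFunction.cardFactors n : ℝ) / L) ^ (m + 1)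
        + ∑ n ∈ Finset.Icc 1 ⌊X⌋₊, ((ArithmeticFunction.cardFactors n : ℝ) / L) ^ m := by
    simp only [Finset.mul_sum, ← Finset.sum_sub_distrib, ← Finset.sum_add_distrib]
    exact Finset.sum_congr rfl fun n _ => by ring
  rw [e]
  linarith [h2.2, h1.1, h0.2, k2.2, k1.1, k0.2]

/-! ### Iterated positive logarithms -/

theorem iterPosLog_nonneg (j : ℕ) {x : ℝ} (hx : 0 ≤ x) : 0 ≤ iterPosLog j x := by
  cases j with
  | zero => exact hx
  | succ j => exact Real.posLog_nonneg

theorem iterPosLog_mono (j : ℕ) {x y : ℝ} (hx : 0 ≤ x) (hxy : x ≤ y) :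
    iterPosLog j x ≤ iterPosLog j y := by
  induction j with
  | zero => exact hxy
  | succ j ih => exact Real.posLog_le_posLog (iterPosLog_nonneg j hx) ih

theorem iterPosLog_succ_eq_log {j : ℕ} {x : ℝ} (hx : 1 ≤ iterPosLog j x) :
    iterPosLog (j + 1) x = Real.log (iterPosLog j x) :=
  Real.posLog_eq_log (by rwa [abs_of_nonneg (by linarith)])

theorem tendsto_iterPosLog_atTop (j : ℕ) : Tendsto (iterPosLog j) atTop atTop := by
  induction j with
  | zero => exact tendsto_id
  | succ j ih =>
    refine (Real.tendsto_log_atTop.comp ih).congr' ?_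
    filter_upwards [ih.eventually_ge_atTop 1] with x hx
    exact (iterPosLog_succ_eq_log hx).symm

theorem iterPosLog_succ_eq (j : ℕ) (x : ℝ) :
    iterPosLog (j + 1) x = iterPosLog j (Real.posLog x) := by
  induction j with
  | zero => rfl
  | succ j ih => exact congrArg Real.posLog ih

theorem iterLog_eventuallyEq_iterPosLog (j : ℕ) : iterLog j =ᶠ[atTop] iterPosLog j := by
  induction j with
  | zero => exact EventuallyEq.rfl
  | succ j ih =>
    filter_upwards [ih, (tendsto_iterPosLog_atTop j).eventually_ge_atTop 1] with x hx h1
    rw [iterPosLog_succ_eq_log h1, ← hx]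
    exact Function.iterate_succ_apply' _ _ _

theorem iterPosLog_add_two_eventuallyEq (j : ℕ) :
    ∀ᶠ X : ℝ in atTop, iterPosLog (j + 2) X = iterPosLog j (Real.log (Real.log X)) := by
  filter_upwards [eventually_ge_atTop 1, Real.tendsto_log_atTop.eventually_ge_atTop 1]
    with X hX hX'
  have h1 : Real.posLog X = Real.log X := Real.posLog_eq_log (hX.trans (le_abs_self X))
  rw [iterPosLog_succ_eq, iterPosLog_succ_eq, h1, Real.posLog_eq_log (hX'.trans (le_abs_self _))]

/-- Inductive step: log(th) = log t + log h ≤ (t - 1) + log h ≤ t log h once log h ≥ 1. It controls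
large t. -/
theorem iterPosLog_mul_le (j : ℕ) :
    ∀ᶠ L : ℝ in atTop, ∀ t : ℝ, 1 ≤ t → iterPosLog j (L * t) ≤ t * iterPosLog j L := by
  induction j with
  | zero => exact Eventually.of_forall fun L t _ => (mul_comm L t).le
  | succ j ih =>
    filter_upwards [ih, (tendsto_iterPosLog_atTop j).eventually_ge_atTop 1,
      (tendsto_iterPosLog_atTop (j + 1)).eventually_ge_atTop 1, eventually_ge_atTop 0]
      with L h h1 h2 hL t ht
    have hmono : iterPosLog j L ≤ iterPosLog j (L * t) :=
      iterPosLog_mono j hL (le_mul_of_one_le_right hL ht)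
    rw [iterPosLog_succ_eq_log (h1.trans hmono)]
    have h3 := Real.log_le_log (by linarith) (h t ht)
    rw [Real.log_mul (by linarith) (by linarith), ← iterPosLog_succ_eq_log h1] at h3
    have h4 := Real.log_le_sub_one_of_pos (by linarith : 0 < t)
    nlinarith

/-! ### First-order expansions uniform in L -/

theorem abs_log_sub_le {u : ℝ} (hu : 1 / 2 ≤ u) :
    |Real.log u - (u - 1)| ≤ 2 * (u - 1) ^ 2 := by
  have hu0 : 0 < u := by linarith
  have h1 := Real.log_le_sub_one_of_pos hu0
  have h2 := Real.one_sub_inv_le_log_of_pos hu0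
  have h3 : (u - 1) - (1 - u⁻¹) ≤ 2 * (u - 1) ^ 2 := by
    have e : (u - 1) - (1 - u⁻¹) = u⁻¹ * (u - 1) ^ 2 := by field_simp
    rw [e]
    refine mul_le_mul_of_nonneg_right ?_ (sq_nonneg _)
    rw [inv_le_comm₀ hu0 two_pos]
    linarith
  rw [abs_le]
  constructor <;> nlinarith [sq_nonneg (u - 1)]

theorem abs_log_le {u : ℝ} (hu : 1 / 2 ≤ u) : |Real.log u| ≤ 2 * |u - 1| := by
  have hu0 : 0 < u := by linarith
  have h1 := Real.log_le_sub_one_of_pos hu0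
  have h2 := Real.one_sub_inv_le_log_of_pos hu0
  have h3 : |1 - u⁻¹| ≤ 2 * |u - 1| := by
    have e : 1 - u⁻¹ = u⁻¹ * (u - 1) := by field_simp
    rw [e, abs_mul, abs_of_pos (inv_pos.mpr hu0)]
    refine mul_le_mul_of_nonneg_right ?_ (abs_nonneg _)
    rw [inv_le_comm₀ hu0 two_pos]
    linarith
  rw [abs_le]
  constructor
  · linarith [neg_abs_le (1 - u⁻¹)]
  · linarith [le_abs_self (u - 1), abs_nonneg (u - 1)]

theorem abs_exp_sub_one_sub_le (v : ℝ) :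
    |Real.exp v - 1 - v| ≤ v ^ 2 * Real.exp |v| := by
  have h := Complex.norm_exp_sub_sum_le_norm_mul_exp (v : ℂ) 2
  have e : Complex.exp v - ∑ m ∈ Finset.range 2, (v : ℂ) ^ m / (m.factorial : ℂ)
      = ((Real.exp v - 1 - v : ℝ) : ℂ) := by
    simp [Finset.sum_range_succ]
    ring
  rw [e, Complex.norm_real, Complex.norm_real, Real.norm_eq_abs, Real.norm_eq_abs, sq_abs] at h
  exact h

theorem exists_abs_rpow_sub_le {α : ℝ} (hα : 0 < α) :
    ∃ K : ℝ, 0 ≤ K ∧ ∀ u : ℝ, 1 / 2 ≤ u → u ≤ 2 →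
      |u ^ α - 1 - α * (u - 1)| ≤ K * (u - 1) ^ 2 := by
  refine ⟨(2 * α) ^ 2 * Real.exp (2 * α) + 2 * α, by positivity, fun u hu hu2 => ?_⟩
  have hu0 : 0 < u := by linarith
  have h1 : |α * Real.log u| ≤ 2 * α * |u - 1| := by
    rw [abs_mul, abs_of_pos hα]
    nlinarith [abs_log_le hu]
  have hu1 : |u - 1| ≤ 1 := abs_le.mpr ⟨by linarith, by linarith⟩
  have h2 : |α * Real.log u| ≤ 2 * α := h1.trans (by nlinarith)
  have h3 : (α * Real.log u) ^ 2 ≤ (2 * α) ^ 2 * (u - 1) ^ 2 := by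
    rw [← sq_abs, ← sq_abs (u - 1), ← mul_pow]
    exact pow_le_pow_left₀ (abs_nonneg _) h1 2
  have h4 := abs_exp_sub_one_sub_le (α * Real.log u)
  have h5 : (α * Real.log u) ^ 2 * Real.exp |α * Real.log u|
      ≤ (2 * α) ^ 2 * (u - 1) ^ 2 * Real.exp (2 * α) :=
    mul_le_mul h3 (Real.exp_le_exp.mpr h2) (Real.exp_pos _).le (by positivity)
  have h6 : |α * (Real.log u - (u - 1))| ≤ 2 * α * (u - 1) ^ 2 := by
    rw [abs_mul, abs_of_pos hα]
    nlinarith [abs_log_sub_le hu]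
  have e : u ^ α - 1 - α * (u - 1)
      = (Real.exp (α * Real.log u) - 1 - α * Real.log u) + α * (Real.log u - (u - 1)) := by
    rw [Real.rpow_def_of_pos hu0, mul_comm (Real.log u) α]
    ring
  rw [e]
  refine (abs_add_le _ _).trans ?_
  linarith

/-- Lets the quadratic error of an outer function of u be measured in t when expansions are
composed. -/
theorem sq_sub_one_le_of_expansion {C c t u : ℝ} (hC : 0 ≤ C) (hc : |c| ≤ C) (ht : |t - 1| ≤ 1)
    (h : |u - 1 - c * (t - 1)| ≤ C * (t - 1) ^ 2) :
    (u - 1) ^ 2 ≤ (2 * C) ^ 2 * (t - 1) ^ 2 := by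
  have h1 : |u - 1| ≤ 2 * C * |t - 1| := by
    calc |u - 1| = |(u - 1 - c * (t - 1)) + c * (t - 1)| := by congr 1; ring
      _ ≤ |u - 1 - c * (t - 1)| + |c * (t - 1)| := abs_add_le _ _
      _ ≤ C * |t - 1| + C * |t - 1| := by
          refine add_le_add (h.trans ?_) ?_
          · rw [← sq_abs]
            refine mul_le_mul_of_nonneg_left ?_ hC
            nlinarith [abs_nonneg (t - 1)]
          · rw [abs_mul]
            exact mul_le_mul_of_nonneg_right hc (abs_nonneg _)
      _ = _ := by ring
  rw [← sq_abs, ← sq_abs (t - 1), ← mul_pow]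
  exact pow_le_pow_left₀ (abs_nonneg _) h1 2

/-- First-order expansion of `t ↦ log_j^+ (L t) / log_j^+ L` near `t = 1`, uniformly in `L`. -/
theorem exists_iterPosLog_ratio_expansion (j : ℕ) :
    ∃ C : ℝ, 0 ≤ C ∧ ∀ᶠ L : ℝ in atTop, ∃ c : ℝ, |c| ≤ C ∧ ∀ t : ℝ, 1 / 2 ≤ t → t ≤ 2 →
      1 / 2 ≤ iterPosLog j (L * t) / iterPosLog j L ∧
      iterPosLog j (L * t) / iterPosLog j L ≤ 2 ∧
      |iterPosLog j (L * t) / iterPosLog j L - 1 - c * (t - 1)| ≤ C * (t - 1) ^ 2 := by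
  induction j with
  | zero =>
    refine ⟨1, zero_le_one, ?_⟩
    filter_upwards [eventually_gt_atTop 0] with L hL
    refine ⟨1, by simp, fun t h1 h2 => ?_⟩
    have e : iterPosLog 0 (L * t) / iterPosLog 0 L = t := mul_div_cancel_left₀ t hL.ne'
    rw [e]
    refine ⟨h1, h2, ?_⟩
    simp only [one_mul, sub_self, abs_zero]
    positivity
  | succ j ih =>
    obtain ⟨C, hC, ih⟩ := ih
    refine ⟨2 * (2 * C) ^ 2 + C, by positivity, ?_⟩
    filter_upwards [ih, (tendsto_iterPosLog_atTop j).eventually_ge_atTop 2,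
      (tendsto_iterPosLog_atTop (j + 1)).eventually_ge_atTop 2] with L hL hj hj1
    obtain ⟨c, hc, hL⟩ := hL
    set h := iterPosLog j L
    set l := iterPosLog (j + 1) L with hl
    have hl0 : 0 < l := by linarith
    have hlog : l = Real.log h := iterPosLog_succ_eq_log (by linarith)
    -- The new ratio is 1 + (log u)/l, so the slope is divided by l. Since |log u| ≤ 1, l ≥ 2 keeps
    -- this ratio in [1/2, 2]; h ≥ 2 ensures hu ≥ 1, so that `Real.posLog` is the logarithm there.
    refine ⟨c / l, ?_, fun t h1 h2 => ?_⟩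
    · rw [abs_div, abs_of_pos hl0]
      exact (div_le_self (abs_nonneg c) (by linarith)).trans (by nlinarith [sq_nonneg C])
    obtain ⟨hu1, hu2, hexp⟩ := hL t h1 h2
    set u := iterPosLog j (L * t) / h with hu
    have hu0 : 0 < u := by linarith
    have hhu : iterPosLog j (L * t) = h * u := by
      rw [hu, mul_div_cancel₀ _ (by linarith : h ≠ 0)]
    have hnum : iterPosLog (j + 1) (L * t) = l + Real.log u := by
      rw [iterPosLog_succ_eq_log (by rw [hhu]; nlinarith), hhu,
        Real.log_mul (by linarith) hu0.ne', hlog]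
    have hratio : iterPosLog (j + 1) (L * t) / l = 1 + Real.log u / l := by
      rw [hnum, add_div, div_self hl0.ne']
    have hlogu : |Real.log u| ≤ 1 := by
      rw [abs_le]
      constructor
      · have := Real.one_sub_inv_le_log_of_pos hu0
        have h3 : u⁻¹ ≤ 2 := by
          rw [inv_le_comm₀ hu0 two_pos]
          linarith
        linarith
      · linarith [Real.log_le_sub_one_of_pos hu0]
    have hq : |Real.log u / l| ≤ 1 / 2 := by
      rw [abs_div, abs_of_pos hl0, div_le_iff₀ hl0]
      linarith
    rw [abs_le] at hq
    rw [hratio]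
    refine ⟨by linarith [hq.1], by linarith [hq.2], ?_⟩
    have e : 1 + Real.log u / l - 1 - c / l * (t - 1)
        = ((Real.log u - (u - 1)) + (u - 1 - c * (t - 1))) / l := by ring
    rw [e, abs_div, abs_of_pos hl0]
    refine (div_le_self (abs_nonneg _) (by linarith)).trans ((abs_add_le _ _).trans ?_)
    have h5 := abs_log_sub_le hu1
    have h6 := sq_sub_one_le_of_expansion hC hc (abs_le.mpr ⟨by linarith, by linarith⟩) hexp
    linarith

/-- Global version of the expansion for `t ↦ (log_j^+ (L t) / log_j^+ L) ^ α` on `t ≥ 0`. -/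
theorem exists_iterPosLog_rpow_ratio_expansion (j : ℕ) {α : ℝ} (hα : 0 < α) :
    ∃ C : ℝ, 0 ≤ C ∧ ∃ m : ℕ, ∀ᶠ L : ℝ in atTop, ∃ c : ℝ, |c| ≤ C ∧ ∀ t : ℝ, 0 ≤ t →
      |(iterPosLog j (L * t) / iterPosLog j L) ^ α - 1 - c * (t - 1)|
        ≤ C * ((t - 1) ^ 2 * (1 + t ^ m)) := by
  obtain ⟨C, hC, hloc⟩ := exists_iterPosLog_ratio_expansion j
  obtain ⟨K, hK, hpow⟩ := exists_abs_rpow_sub_le hα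
  -- The exponent ⌈α⌉ is chosen so that u^α ≤ t^α ≤ t^⌈α⌉ for t > 2.
  refine ⟨K * (2 * C) ^ 2 + 4 * (1 + α * C), by positivity, ⌈α⌉₊, ?_⟩
  filter_upwards [hloc, iterPosLog_mul_le j, (tendsto_iterPosLog_atTop j).eventually_ge_atTop 1,
    eventually_ge_atTop 0] with L hL hgrow hj hL0
  obtain ⟨c, hc, hL⟩ := hL
  have hαc : |α * c| ≤ α * C := by
    rw [abs_mul, abs_of_pos hα]
    exact mul_le_mul_of_nonneg_left hc hα.le
  have hαC : 0 ≤ α * C := by positivity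
  have hKC : 0 ≤ K * (2 * C) ^ 2 := by positivity
  refine ⟨α * c, hαc.trans (by linarith), fun t ht => ?_⟩
  have hj0 : 0 < iterPosLog j L := by linarith
  have hnn : 0 ≤ iterPosLog j (L * t) := iterPosLog_nonneg j (mul_nonneg hL0 ht)
  set u := iterPosLog j (L * t) / iterPosLog j L with hu
  have hu0 : 0 ≤ u := div_nonneg hnn hj0.le
  have htm : 0 ≤ t ^ ⌈α⌉₊ := pow_nonneg ht _
  have hsq := sq_nonneg (t - 1)
  have hct : |α * c * (t - 1)| ≤ α * C * |t - 1| := by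
    rw [abs_mul]
    exact mul_le_mul_of_nonneg_right hαc (abs_nonneg _)
  -- The local expansion serves on [1/2, 2]. Elsewhere crude bounds suffice, because (t-1)² is at
  -- least 1/4 below 1/2 and at least 1 above 2.
  rcases lt_or_ge t (1 / 2) with h1 | h1
  · have hu1 : u ≤ 1 := by
      rw [hu, div_le_one hj0]
      exact iterPosLog_mono j (mul_nonneg hL0 ht) (mul_le_of_le_one_right hL0 (by linarith))
    have hw0 : 0 ≤ u ^ α := Real.rpow_nonneg hu0 α
    have hw1 : u ^ α ≤ 1 := Real.rpow_le_one hu0 hu1 hα.le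
    have h2 : |t - 1| ≤ 1 := abs_le.mpr ⟨by linarith, by linarith⟩
    have h3 : |u ^ α - 1| ≤ 1 := abs_le.mpr ⟨by linarith, by linarith⟩
    have h4 : 1 / 4 ≤ (t - 1) ^ 2 := by nlinarith
    have h5 : 1 / 4 ≤ (t - 1) ^ 2 * (1 + t ^ ⌈α⌉₊) := by nlinarith [mul_nonneg hsq htm]
    refine (abs_sub _ _).trans ?_
    have h6 : α * C * |t - 1| ≤ α * C * 1 := mul_le_mul_of_nonneg_left h2 hαC
    have h7 := mul_le_mul_of_nonneg_left h5
      (by linarith : 0 ≤ K * (2 * C) ^ 2 + 4 * (1 + α * C))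
    linarith
  rcases le_or_gt t 2 with h2 | h2
  · obtain ⟨hu1, hu2, hexp⟩ := hL t h1 h2
    have h3 := hpow u hu1 hu2
    have h4 := sq_sub_one_le_of_expansion hC hc (abs_le.mpr ⟨by linarith, by linarith⟩) hexp
    have h5 := mul_le_mul_of_nonneg_left h4 hK
    have h6 : |α * (u - 1 - c * (t - 1))| ≤ α * (C * (t - 1) ^ 2) := by
      rw [abs_mul, abs_of_pos hα]
      exact mul_le_mul_of_nonneg_left hexp hα.le
    have e : u ^ α - 1 - α * c * (t - 1)
        = (u ^ α - 1 - α * (u - 1)) + α * (u - 1 - c * (t - 1)) := by ring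
    rw [e]
    refine (abs_add_le _ _).trans ?_
    have h7 : (K * (2 * C) ^ 2 + 4 * (1 + α * C)) * (t - 1) ^ 2
        ≤ (K * (2 * C) ^ 2 + 4 * (1 + α * C)) * ((t - 1) ^ 2 * (1 + t ^ ⌈α⌉₊)) := by
      refine mul_le_mul_of_nonneg_left ?_ (by linarith)
      nlinarith [mul_nonneg hsq htm]
    have h8 := mul_nonneg hαC hsq
    nlinarith
  · have hut : u ≤ t := by
      rw [hu, div_le_iff₀ hj0]
      exact hgrow t (by linarith)
    have hw0 : 0 ≤ u ^ α := Real.rpow_nonneg hu0 α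
    have hw1 : u ^ α ≤ t ^ ⌈α⌉₊ := by
      refine (Real.rpow_le_rpow hu0 hut hα.le).trans ?_
      rw [← Real.rpow_natCast]
      exact Real.rpow_le_rpow_of_exponent_le (by linarith) (Nat.le_ceil α)
    have h3 : |u ^ α - 1| ≤ 1 + t ^ ⌈α⌉₊ := abs_le.mpr ⟨by linarith, by linarith⟩
    have h4 : |t - 1| ≤ (t - 1) ^ 2 := by
      rw [abs_of_pos (by linarith)]
      nlinarith
    have h5 : 1 ≤ (t - 1) ^ 2 := by nlinarith
    refine (abs_sub _ _).trans ?_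
    have h6 := mul_le_mul_of_nonneg_left h4 hαC
    have h7 : 1 + t ^ ⌈α⌉₊ ≤ (t - 1) ^ 2 * (1 + t ^ ⌈α⌉₊) :=
      le_mul_of_one_le_left (by linarith) h5
    have h8 : (t - 1) ^ 2 ≤ (t - 1) ^ 2 * (1 + t ^ ⌈α⌉₊) :=
      le_mul_of_one_le_right hsq (by linarith)
    have h9 := mul_le_mul_of_nonneg_left h8 hαC
    have h10 : 0 ≤ (K * (2 * C) ^ 2 + 3 + 3 * (α * C)) * ((t - 1) ^ 2 * (1 + t ^ ⌈α⌉₊)) :=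
      mul_nonneg (by linarith) (by linarith)
    linarith

/-! ### Averaging the expansion -/

/-- After factoring out G = (log_j^+ L)^α, three errors remain: the quadratic remainder (weighted
variance), the linear term (moments 1 and 0, with c independent of n), and ⌊X⌋ - X. -/
theorem exists_summatory_sub_le (j : ℕ) {α : ℝ} (hα : 0 < α) :
    ∃ C : ℝ, ∀ᶠ X : ℝ in atTop,
      |summatory (fun n => iterPosLogOmega j n ^ α) X
          - X * iterPosLog j (Real.log (Real.log X)) ^ α|
        ≤ C * (X * iterPosLog j (Real.log (Real.log X)) ^ α / Real.log (Real.log X)) := by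
  obtain ⟨C, hC, m, hexp⟩ := exists_iterPosLog_rpow_ratio_expansion j hα
  obtain ⟨V, hV⟩ := exists_weighted_variance_le m
  obtain ⟨A, hA⟩ := exists_moment_sub_le 1
  obtain ⟨B, hB⟩ := exists_moment_sub_le 0
  refine ⟨C * V + C * (A + B) + B, ?_⟩
  filter_upwards [tendsto_log_log_atTop.eventually hexp, hV, hA, hB,
    tendsto_log_log_atTop.eventually_gt_atTop 0,
    tendsto_log_log_atTop.eventually ((tendsto_iterPosLog_atTop j).eventually_gt_atTop 0)]
    with X hexp hV hA hB hL hH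
  obtain ⟨c, hc, hexp⟩ := hexp
  set L := Real.log (Real.log X)
  set N := ⌊X⌋₊
  set G := iterPosLog j L ^ α with hG
  have hG0 : 0 < G := Real.rpow_pos_of_pos hH α
  set t : ℕ → ℝ := fun n => (ArithmeticFunction.cardFactors n : ℝ) / L with ht
  have ht0 : ∀ n, 0 ≤ t n := fun n => by positivity
  have hLt : ∀ n, L * t n = ArithmeticFunction.cardFactors n := fun n =>
    mul_div_cancel₀ _ hL.ne'
  set w : ℕ → ℝ := fun n => (iterPosLog j (L * t n) / iterPosLog j L) ^ α with hw
  have hwG : ∀ n, iterPosLogOmega j n ^ α = G * w n := by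
    intro n
    have h1 : 0 ≤ iterPosLog j (L * t n) := iterPosLog_nonneg j (mul_nonneg hL.le (ht0 n))
    rw [hw, hG]
    simp only
    rw [Real.div_rpow h1 hH.le, mul_div_cancel₀ _ (Real.rpow_pos_of_pos hH α).ne', hLt]
    rfl
  have hrem : |∑ n ∈ Finset.Icc 1 N, (w n - 1 - c * (t n - 1))| ≤ C * (V * (X / L)) := by
    refine (Finset.abs_sum_le_sum_abs _ _).trans
      ((Finset.sum_le_sum fun n _ => hexp (t n) (ht0 n)).trans ?_)
    rw [← Finset.mul_sum]
    exact mul_le_mul_of_nonneg_left hV hC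
  have hlin : |c * (∑ n ∈ Finset.Icc 1 N, t n ^ 1 - ∑ n ∈ Finset.Icc 1 N, t n ^ 0)|
      ≤ C * ((A + B) * (X / L)) := by
    rw [abs_mul]
    refine mul_le_mul hc ?_ (abs_nonneg _) hC
    have e : ∑ n ∈ Finset.Icc 1 N, t n ^ 1 - ∑ n ∈ Finset.Icc 1 N, t n ^ 0
        = (∑ n ∈ Finset.Icc 1 N, t n ^ 1 - X) - (∑ n ∈ Finset.Icc 1 N, t n ^ 0 - X) := by ring
    rw [e]
    refine (abs_sub _ _).trans ?_
    linarith
  have hdecomp : summatory (fun n => iterPosLogOmega j n ^ α) X - X * G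
      = G * ((∑ n ∈ Finset.Icc 1 N, (w n - 1 - c * (t n - 1)))
        + c * (∑ n ∈ Finset.Icc 1 N, t n ^ 1 - ∑ n ∈ Finset.Icc 1 N, t n ^ 0)
        + (∑ n ∈ Finset.Icc 1 N, t n ^ 0 - X)) := by
    have h1 : summatory (fun n => iterPosLogOmega j n ^ α) X
        = G * ∑ n ∈ Finset.Icc 1 N, w n := by
      rw [summatory, Finset.mul_sum]
      exact Finset.sum_congr rfl fun n _ => hwG n
    have h2 : ∑ n ∈ Finset.Icc 1 N, (w n - 1 - c * (t n - 1))
        = ∑ n ∈ Finset.Icc 1 N, w n - ∑ n ∈ Finset.Icc 1 N, t n ^ 0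
          - c * (∑ n ∈ Finset.Icc 1 N, t n ^ 1 - ∑ n ∈ Finset.Icc 1 N, t n ^ 0) := by
      rw [← Finset.sum_sub_distrib, ← Finset.sum_sub_distrib, Finset.mul_sum,
        ← Finset.sum_sub_distrib]
      exact Finset.sum_congr rfl fun n _ => by rw [pow_zero, pow_one]
    rw [h1, h2]
    ring
  rw [hdecomp, abs_mul, abs_of_pos hG0]
  have h3 := mul_le_mul_of_nonneg_left ((abs_add_three _ _ _).trans
    (add_le_add (add_le_add hrem hlin) hB)) hG0.le
  refine h3.trans (le_of_eq ?_)
  ring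

theorem eventually_summatory_bounds (j : ℕ) {α : ℝ} (hα : 0 < α) :
    ∀ᶠ X : ℝ in atTop,
      1 / 2 * iterPosLog (j + 2) X ^ α
          ≤ 1 / X * summatory (fun n => iterPosLogOmega j n ^ α) X ∧
      1 / X * summatory (fun n => iterPosLogOmega j n ^ α) X
          ≤ 3 / 2 * iterPosLog (j + 2) X ^ α := by
  obtain ⟨C, hC⟩ := exists_summatory_sub_le j hα
  filter_upwards [hC, iterPosLog_add_two_eventuallyEq j, eventually_gt_atTop 0,
    tendsto_log_log_atTop.eventually_ge_atTop (max 1 (2 * C)),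
    tendsto_log_log_atTop.eventually ((tendsto_iterPosLog_atTop j).eventually_gt_atTop 0)]
    with X h he hX hL hH
  rw [he]
  set L := Real.log (Real.log X)
  set G := iterPosLog j L ^ α
  have hL0 : 0 < L := one_pos.trans_le ((le_max_left _ _).trans hL)
  have hCL : C / L ≤ 1 / 2 := by
    rw [div_le_iff₀ hL0]
    linarith [(le_max_right 1 (2 * C)).trans hL]
  have hXG : 0 < X * G := mul_pos hX (Real.rpow_pos_of_pos hH α)
  have h1 : C * (X * G / L) ≤ 1 / 2 * (X * G) := by
    calc C * (X * G / L) = C / L * (X * G) := by ring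
      _ ≤ _ := mul_le_mul_of_nonneg_right hCL hXG.le
  have h2 := abs_le.mp (h.trans h1)
  rw [one_div_mul_eq_div X, le_div_iff₀ hX, div_le_iff₀ hX]
  constructor <;> linarith [h2.1, h2.2]

theorem isTheta_of_eventually_bounds {f g : ℝ → ℝ} {a b : ℝ} (ha : 0 < a)
    (hg : ∀ᶠ x in atTop, 0 ≤ g x)
    (h : ∀ᶠ x in atTop, a * g x ≤ f x ∧ f x ≤ b * g x) : f =Θ[atTop] g := by
  constructor
  · refine IsBigO.of_bound b ?_
    filter_upwards [hg, h] with x hx h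
    rw [Real.norm_of_nonneg hx, Real.norm_of_nonneg ((mul_nonneg ha.le hx).trans h.1)]
    exact h.2
  · refine IsBigO.of_bound a⁻¹ ?_
    filter_upwards [hg, h] with x hx h
    rw [Real.norm_of_nonneg hx, Real.norm_of_nonneg ((mul_nonneg ha.le hx).trans h.1),
      inv_mul_eq_div, le_div_iff₀ ha]
    linarith [h.1]

theorem one_add_rpow_le {h α : ℝ} (hh : 0 ≤ h) (hα : 0 < α) :
    (1 + h) ^ α ≤ 2 ^ α * (1 + h ^ α) := by
  have h0 : 0 ≤ h ^ α := Real.rpow_nonneg hh α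
  have h2 : (0 : ℝ) ≤ 2 ^ α := by positivity
  rcases le_total h 1 with h1 | h1
  · refine (Real.rpow_le_rpow (by linarith) (by linarith : 1 + h ≤ 2) hα.le).trans ?_
    exact le_mul_of_one_le_right h2 (by linarith)
  · refine (Real.rpow_le_rpow (by linarith) (by linarith : 1 + h ≤ 2 * h) hα.le).trans ?_
    rw [Real.mul_rpow two_pos.le hh]
    exact mul_le_mul_of_nonneg_left (by linarith) h2

theorem iterPosLogOmega_nonneg (j n : ℕ) : 0 ≤ iterPosLogOmega j n :=
  iterPosLog_nonneg j (Nat.cast_nonneg _)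

theorem mainTheorem3 (j : ℕ) (α : ℝ) (hα : 0 < α) :
    ((fun X : ℝ => summatory (fun n => iterPosLogOmega j n ^ α) X - X * iterLog (j + 2) X ^ α)
      =O[atTop] fun X : ℝ => X * iterLog (j + 2) X ^ α / iterLog 2 X) ∧
    HasAverageOrder (fun n => iterPosLogOmega j n ^ α) (fun X => iterPosLog (j + 2) X ^ α) ∧
    HasAverageOrder (logWeight j α) (fun X => iterPosLog (j + 2) X ^ α) := by
  have hge : ∀ᶠ X : ℝ in atTop, 1 ≤ iterPosLog (j + 2) X :=
    (tendsto_iterPosLog_atTop (j + 2)).eventually_ge_atTop 1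
  have hnn : ∀ᶠ X : ℝ in atTop, 0 ≤ iterPosLog (j + 2) X ^ α :=
    hge.mono fun X hX => Real.rpow_nonneg (by linarith) α
  have hbounds := eventually_summatory_bounds j hα
  refine ⟨?_, isTheta_of_eventually_bounds one_half_pos hnn hbounds,
    isTheta_of_eventually_bounds (b := 2 ^ α * (1 + 3 / 2)) one_half_pos hnn ?_⟩
  · obtain ⟨C, hC⟩ := exists_summatory_sub_le j hα
    refine IsBigO.of_bound C ?_
    filter_upwards [hC, iterPosLog_add_two_eventuallyEq j,
      iterLog_eventuallyEq_iterPosLog (j + 2), eventually_ge_atTop 0, hnn,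
      tendsto_log_log_atTop.eventually_ge_atTop 0] with X h he he' hX hG hL
    have h2 : iterLog 2 X = Real.log (Real.log X) := rfl
    rw [he', he, h2] at *
    rw [Real.norm_eq_abs, Real.norm_of_nonneg (div_nonneg (mul_nonneg hX hG) hL)]
    exact h
  · filter_upwards [hbounds, hge, eventually_gt_atTop 0] with X h hG hX
    have hX' : 0 ≤ 1 / X := by positivity
    constructor
    · refine h.1.trans (mul_le_mul_of_nonneg_left (Finset.sum_le_sum fun n _ => ?_) hX')
      exact Real.rpow_le_rpow (iterPosLogOmega_nonneg j n) (by linarith) hα.le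
    · have h1 : summatory (logWeight j α) X
          ≤ 2 ^ α * (X + summatory (fun n => iterPosLogOmega j n ^ α) X) := by
        calc summatory (logWeight j α) X
            ≤ ∑ n ∈ Finset.Icc 1 ⌊X⌋₊, 2 ^ α * (1 + iterPosLogOmega j n ^ α) :=
              Finset.sum_le_sum fun n _ => one_add_rpow_le (iterPosLogOmega_nonneg j n) hα
          _ = 2 ^ α * (⌊X⌋₊ + summatory (fun n => iterPosLogOmega j n ^ α) X) := by
              rw [← Finset.mul_sum, Finset.sum_add_distrib]
              simp [summatory]
          _ ≤ _ := by
              gcongr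
              exact Nat.floor_le hX.le
      -- The 1 in the weight contributes a multiple of X, absorbed because the average order is
      -- eventually at least 1.
      have hG1 : 1 ≤ iterPosLog (j + 2) X ^ α := Real.one_le_rpow hG hα.le
      calc 1 / X * summatory (logWeight j α) X
          ≤ 1 / X * (2 ^ α * (X + summatory (fun n => iterPosLogOmega j n ^ α) X)) :=
            mul_le_mul_of_nonneg_left h1 hX'
        _ = 2 ^ α * (1 + 1 / X * summatory (fun n => iterPosLogOmega j n ^ α) X) := by
            field_simp
        _ ≤ 2 ^ α * ((1 + 3 / 2) * iterPosLog (j + 2) X ^ α) := by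
            gcongr
            linarith [h.2]
        _ = _ := by ring
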